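/- Let $A$ and $B$ be unital complex Banach algebras with units $e$. For an element $x$ of a unital complex algebra with unit $e$, call $x$ *Drazin invertible* if there are an element $y$ of the algebra and an integer $m\ge 0$ with $x^m y x = x^m$, $yxy = y$ and $xy = yx$, and let $$\sigma_{DR}(x)=\{\lambda\in\mathbb C : x-\lambda e \text{ is not Drazin invertible}\}$$ be the *Drazin spectrum* of $x$. Let $\sigma(x)$ be the usual spectrum. For $x$ in a unital Banach algebra, let $\Pi(x)$ be the set of poles of $x$, i.e. the set of isolated points of $\sigma(x)$ that are poles (of some order $p\ge 1$) of the resolvent function $\lambda\mapsto(\lambda e-x)^{-1}$. Let $\alpha$ be a submultiplicative norm on the algebraic tensor product $A\otimes B$ that is a uniform crossnorm, that is, $\alpha(x\otimes y)=\|x\|\,\|y\|$ for all $x\in A$, $y\in B$, and $\alpha((S\otimes T)z)\le\|S\|\,\|T\|\,\alpha(z)$ for all bounded linear operators $S$ on $A$ and $T$ on $B$ and all $z\in A\otimes B$. Let $A\overline{\otimes}B$ be the Banach algebra obtained by completing $A\otimes B$ with respect to $\alpha$. Let $a\in A$, $b\in B$, regard $a\otimes b$ as an element of $A\overline{\otimes}B$,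 and put $$\mathbb D=\sigma(a)\,\sigma_{DR}(b)\,\cup\,\sigma_{DR}(a)\,\sigma(b),$$ where $KL=\{\lambda\mu : \lambda\in K,\ \mu\in L\}$ for $K,L\subseteq\mathbb C$. Then: (i) If $\sigma(a)=\Pi(a)$ and $\sigma(b)=\Pi(b)$, then $\mathbb D=\emptyset=\sigma_{DR}(a\otimes b)$. (ii) If $\sigma_{DR}(a)\ne\emptyset$ or $\sigma_{DR}(b)\ne\emptyset$, then $\sigma_{DR}(a\otimes b)\setminus\{0\}=\mathbb D\setminus\{0\}$ and $\sigma_{DR}(a\otimes b)\subseteq\mathbb D$. -/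

import Mathlib

open scoped TensorProduct Pointwise Topology

namespace DrazinTensor

section Spectra

/-- `x` is Drazin invertible: for some `y` and some natural number `m`,
`x ^ m * y * x = x ^ m`, `y * x * y = y` and `x * y = y * x`. -/
def IsDrazinInvertible {R : Type*} [Ring R] (x : R) : Prop :=
  ∃ (y : R) (m : ℕ), x ^ m * y * x = x ^ m ∧ y * x * y = y ∧ x * y = y * x

/-- The Drazin spectrum: the complex numbers `z` for which `a - z` is not Drazin invertible. -/
def drazinSpectrum {R : Type*} [Ring R] [Algebra ℂ R] (a : R) : Set ℂ :=
  {z | ¬ IsDrazinInvertible (a - algebraMap ℂ R z)}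

/-- The isolated points of a set of complex numbers. -/
def isoPoints (K : Set ℂ) : Set ℂ :=
  {z | z ∈ K ∧ ¬ AccPt z (Filter.principal K)}

/-- The set of poles of `a`: the isolated points of the spectrum at which the Laurent expansion of
the resolvent function has a principal part that is non-zero and has only finitely many terms, that
is, at which the resolvent function is meromorphic of negative order.
(If the function is not meromorphic at the point, `meromorphicOrderAt` is `0`.) -/
def poles {A : Type*} [NormedRing A] [NormedAlgebra ℂ A] (a : A) : Set ℂ :=
  {z | z ∈ isoPoints (spectrum ℂ a) ∧ meromorphicOrderAt (resolvent a : ℂ → A) z < 0}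

/-- The set `σ(a) σ_DR(b) ∪ σ_DR(a) σ(b)`, where the products are sets of products. -/
def productSet {A B : Type*} [Ring A] [Algebra ℂ A] [Ring B] [Algebra ℂ B]
    (a : A) (b : B) : Set ℂ :=
  spectrum ℂ a * drazinSpectrum b ∪ drazinSpectrum a * spectrum ℂ b

end Spectra

section Tensor

variable {A B : Type*} [NormedRing A] [NormedAlgebra ℂ A] [NormedRing B] [NormedAlgebra ℂ B]

/-- An algebra norm (a submultiplicative norm) on the algebraic tensor product `A ⊗ B` is a uniform
crossnorm if `‖x ⊗ y‖ = ‖x‖ ‖y‖` for all `x`, `y`, and if for all bounded linear operators `S` on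
`A` and `T` on `B` the operator `S ⊗ T` is bounded with norm at most `‖S‖ ‖T‖`. -/
structure IsUniformCrossnorm (α : AlgebraNorm ℂ (A ⊗[ℂ] B)) : Prop where
  cross : ∀ (x : A) (y : B), α (x ⊗ₜ[ℂ] y) = ‖x‖ * ‖y‖
  uniform : ∀ (S : A →L[ℂ] A) (T : B →L[ℂ] B) (z : A ⊗[ℂ] B),
    α (TensorProduct.map (S : A →ₗ[ℂ] A) (T : B →ₗ[ℂ] B) z) ≤ ‖S‖ * ‖T‖ * α z

/-- The algebra `A ⊗ B`, as a type that carries the norm `α`. -/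
def NormedTensor (_α : AlgebraNorm ℂ (A ⊗[ℂ] B)) : Type _ := A ⊗[ℂ] B

noncomputable instance (α : AlgebraNorm ℂ (A ⊗[ℂ] B)) : NormedRing (NormedTensor α) :=
  RingNorm.toNormedRing (R := A ⊗[ℂ] B) α.toRingNorm

noncomputable instance (α : AlgebraNorm ℂ (A ⊗[ℂ] B)) : NormedAlgebra ℂ (NormedTensor α) where
  __ := (inferInstance : Algebra ℂ (A ⊗[ℂ] B))
  norm_smul_le c x := (map_smul_eq_mul α c (show A ⊗[ℂ] B from x)).le

/-- The identity map, from the algebra `A ⊗ B` to the same algebra with the norm `α`. -/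
noncomputable def toNormedTensor (α : AlgebraNorm ℂ (A ⊗[ℂ] B)) : A ⊗[ℂ] B ≃ₐ[ℂ] NormedTensor α :=
  (AlgEquiv.refl : A ⊗[ℂ] B ≃ₐ[ℂ] A ⊗[ℂ] B)

/-- The completion of `A ⊗ B` with respect to `α`; it is a complete normed ring. -/
abbrev CompletedTensor (α : AlgebraNorm ℂ (A ⊗[ℂ] B)) : Type _ :=
  UniformSpace.Completion (NormedTensor α)

/-- The completion is a Banach algebra: its algebra structure is compatible with its norm. -/
noncomputable instance (α : AlgebraNorm ℂ (A ⊗[ℂ] B)) : NormedAlgebra ℂ (CompletedTensor α) where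
  __ := (inferInstance : Algebra ℂ (UniformSpace.Completion (NormedTensor α)))
  norm_smul_le := norm_smul_le

/-- The elementary tensor `a ⊗ b` as an element of the completion. -/
noncomputable def elementaryTensor (α : AlgebraNorm ℂ (A ⊗[ℂ] B)) (a : A) (b : B) :
    CompletedTensor α :=
  (toNormedTensor α (a ⊗ₜ[ℂ] b) : UniformSpace.Completion (NormedTensor α))

end Tensor

end DrazinTensor

open DrazinTensor

/-! Drazin invertibility of `x` amounts to strong π-regularity: `x ^ m = w * x ^ (m + 1)` and `x ^ n
= x ^ (n + 1) * v` for some `w`, `v`, `m`, `n` (`isDrazinInvertible_of_pow_eq`). These one-sided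
equations are easier to transport than a Drazin inverse.

Upper bound: a ⊗ b is the product of the commuting elements u = a ⊗ 1 and v = 1 ⊗ b. In their
bicommutant, a commutative Banach algebra, failure of π-regularity of uv - z gives a character φ
with φ(u)φ(v) = z. If u - φ(u) and v - φ(v) were both Drazin invertible, the product of their
spectral idempotents would lie in ker φ, although φ maps it to 1 (`isDrazinInvertible_mul_sub`).
Poles are points of Drazin invertibility, so under (i) the product set is empty, and the upper bound
finishes.

Lower bound: let s ∈ σ(a), t ∈ σ_DR(b), st ≠ 0. If a - s has no left inverse, Hahn-Banach gives f
with f(1) = 1 and f(xa) = s f(x). The slice map f ⊗ id, bounded because the crossnorm is uniform,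
carries a left regularity equation for a ⊗ b - st to one for b - t; right inverses are symmetric. If
s is in both one-sided spectra, this makes b - t Drazin invertible, a contradiction. If s is in only
one, topology takes over: Drazin invertibility would isolate st in σ(a ⊗ b), but there are spectral
points accumulating at st (`false_of_mul_eq`). -/

namespace DrazinTensor


/-! ### Drazin invertibility as strong π-regularity -/

section Ring

variable {R : Type*} [Ring R]

/-- A Drazin inverse of `x` commutes with every element that commutes with `x`. -/
theorem commute_of_drazin_inverse {x y c : R} {m : ℕ} (h₁ : x ^ m * y * x = x ^ m)
    (h₂ : y * x * y = y) (h₃ : x * y = y * x) (hc : Commute c x) : Commute c y := by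
  have hxy : Commute x y := h₃
  obtain ⟨e, he⟩ : ∃ e, e = x * y := ⟨_, rfl⟩
  have he' : e = y * x := he.trans h₃
  have hee : e * e = e := by rw [he', ← mul_assoc, h₂]
  have hepow : ∀ k : ℕ, e ^ (k + 1) = e := fun k => by
    induction k with
    | zero => simp
    | succ k ih => rw [pow_succ, ih, hee]
  have hx : x ^ (m + 1) * e = x ^ (m + 1) := by
    rw [pow_succ', mul_assoc, he', ← mul_assoc (x ^ m), h₁]
  have hxe : Commute x e := he ▸ (Commute.refl x).mul_right hxy
  have hx' : e * x ^ (m + 1) = x ^ (m + 1) := by rw [← (hxe.pow_left _).eq, hx]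
  -- With the idempotent `e` a multiple of `x ^ (m + 1)` on either side, `c` passes through that
  -- power, and both `e * c` and `c * e` equal `e * c * e`.
  have e₁ : e = x ^ (m + 1) * y ^ (m + 1) := by rw [← hxy.mul_pow, ← he, hepow]
  have e₂ : e = y ^ (m + 1) * x ^ (m + 1) := by rw [← hxy.symm.mul_pow, ← he', hepow]
  have hck : c * x ^ (m + 1) = x ^ (m + 1) * c := (hc.pow_right _).eq
  have l₁ : e * c = e * c * e := by
    calc e * c = y ^ (m + 1) * (x ^ (m + 1) * c) := by rw [← mul_assoc, ← e₂]
      _ = y ^ (m + 1) * (c * (x ^ (m + 1) * e)) := by rw [hx, hck]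
      _ = y ^ (m + 1) * x ^ (m + 1) * c * e := by
        rw [← mul_assoc c, hck]; simp only [mul_assoc]
      _ = e * c * e := by rw [← e₂]
  have l₂ : c * e = e * c * e := by
    calc c * e = c * x ^ (m + 1) * y ^ (m + 1) := by rw [mul_assoc, ← e₁]
      _ = e * x ^ (m + 1) * c * y ^ (m + 1) := by rw [hx', hck]
      _ = e * c * (x ^ (m + 1) * y ^ (m + 1)) := by
        rw [mul_assoc e, ← hck]; simp only [mul_assoc]
      _ = e * c * e := by rw [← e₁]
  have hce : c * e = e * c := l₂.trans l₁.symm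
  have hye : y * e = y := by rw [he, ← mul_assoc, h₂]
  have hey : e * y = y := by rw [he', h₂]
  calc c * y = e * c * y := by rw [← hce, mul_assoc, hey]
    _ = y * (x * c) * y := by rw [he']; simp only [mul_assoc]
    _ = y * (c * e) := by rw [← hc.eq, he]; simp only [mul_assoc]
    _ = y * c := by rw [hce, ← mul_assoc, hye]

theorem pow_eq_pow_mul_of_left_regular {x w : R} {n : ℕ} (h : x ^ n = w * x ^ (n + 1)) (j : ℕ) :
    x ^ n = w ^ j * x ^ (n + j) := by
  induction j with
  | zero => simp
  | succ j ih =>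
    rw [pow_succ, show n + (j + 1) = n + 1 + j by ring, pow_add x (n + 1), mul_assoc,
      ← mul_assoc w, ← h, ← pow_add, ← ih]

theorem pow_eq_mul_pow_of_right_regular {x v : R} {n : ℕ} (h : x ^ n = x ^ (n + 1) * v) (j : ℕ) :
    x ^ n = x ^ (n + j) * v ^ j := by
  induction j with
  | zero => simp
  | succ j ih =>
    rw [pow_succ', show n + (j + 1) = j + (n + 1) by ring, pow_add x j, ← mul_assoc,
      mul_assoc (x ^ j), ← h, ← pow_add, add_comm j, ← ih]

/-- An element that is strongly regular on both sides has a group inverse. -/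
theorem exists_group_inverse {c W V : R} (hW : c = W * (c * c)) (hV : c = c * c * V) :
    ∃ g, c * g * c = c ∧ g * c * g = g ∧ c * g = g * c := by
  have h : W * c = c * V := by
    calc W * c = W * (c * c * V) := by rw [← hV]
      _ = W * (c * c) * V := by simp only [mul_assoc]
      _ = c * V := by rw [← hW]
  have hcc : c * V * c = c := by rw [← h, mul_assoc, ← hW]
  have h₁ : c * (W * c * V) = c * V := by
    rw [h, ← mul_assoc, ← mul_assoc, ← hV]
  have h₂ : W * c * V * c = c * V := by
    rw [mul_assoc W, mul_assoc W, hcc, h]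
  refine ⟨W * c * V, by rw [h₁, hcc], ?_, by rw [h₁, h₂]⟩
  rw [h₂]
  calc c * V * (W * c * V) = c * V * (c * V * V) := by rw [h]
    _ = c * V * c * V * V := by simp only [mul_assoc]
    _ = W * c * V := by rw [hcc, h]

/-- A strongly `π`-regular element is Drazin invertible. -/
theorem isDrazinInvertible_of_pow_eq {x w v : R} {m n : ℕ} (hw : x ^ m = w * x ^ (m + 1))
    (hv : x ^ n = x ^ (n + 1) * v) : IsDrazinInvertible x := by
  -- A common exponent for both equations, positive so that the group inverse `g` of `x ^ k` yields
  -- the Drazin inverse `x ^ (k - 1) * g`.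
  obtain ⟨k, hk⟩ : ∃ k, k = m + n + 1 := ⟨_, rfl⟩
  have hw' : x ^ k = w * x ^ (k + 1) := by
    rw [hk, show m + n + 1 + 1 = m + 1 + (n + 1) by ring, pow_add x (m + 1), ← mul_assoc, ← hw,
      ← pow_add, add_assoc]
  have hv' : x ^ k = x ^ (k + 1) * v := by
    rw [hk, show m + n + 1 + 1 = m + 1 + (n + 1) by ring, pow_add x (m + 1), mul_assoc, ← hv,
      ← pow_add]
    congr 1; ring
  have hW : x ^ k = w ^ k * (x ^ k * x ^ k) := by
    rw [← pow_add]; exact pow_eq_pow_mul_of_left_regular hw' k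
  have hV : x ^ k = x ^ k * x ^ k * v ^ k := by
    rw [← pow_add]; exact pow_eq_mul_pow_of_right_regular hv' k
  obtain ⟨g, h₁, h₂, h₃⟩ := exists_group_inverse hW hV
  have hxg : Commute x g := commute_of_drazin_inverse (m := 1) (by simpa using h₁) h₂ h₃
    (Commute.self_pow x k)

  have e : x * (x ^ (m + n) * g) = x ^ k * g := by rw [← mul_assoc, ← pow_succ', hk]
  have hc : Commute x (x ^ (m + n) * g) := (Commute.self_pow x _).mul_right hxg
  refine ⟨x ^ (m + n) * g, k, ?_, ?_, hc⟩
  · rw [mul_assoc, ← hc.eq, e, h₃, ← mul_assoc, h₁]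
  · rw [← hc.eq, e, ← mul_assoc, mul_assoc (x ^ k), ← (hxg.pow_left (m + n)).eq,
      ← mul_assoc, ((Commute.refl x).pow_pow k (m + n)).eq, mul_assoc, mul_assoc, ← mul_assoc _ g,
      h₃, h₂]

theorem IsDrazinInvertible.exists_pow_eq {x : R} (h : IsDrazinInvertible x) :
    ∃ (y : R) (m : ℕ), x ^ m = y * x ^ (m + 1) ∧ x ^ m = x ^ (m + 1) * y := by
  obtain ⟨y, m, h₁, -, h₃⟩ := h
  have hxy : Commute x y := h₃
  have : x ^ m = x ^ (m + 1) * y := by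
    rw [pow_succ, mul_assoc, h₃, ← mul_assoc, h₁]
  exact ⟨y, m, by rw [← (hxy.pow_left _).eq, ← this], this⟩

theorem isDrazinInvertible_of_isUnit {x : R} (h : IsUnit x) : IsDrazinInvertible x := by
  obtain ⟨u, rfl⟩ := h
  exact ⟨↑u⁻¹, 0, by simp⟩

theorem IsDrazinInvertible.map {S F : Type*} [Ring S] [FunLike F R S] [RingHomClass F R S] (f : F)
    {x : R} (h : IsDrazinInvertible x) : IsDrazinInvertible (f x) := by
  obtain ⟨y, m, h₁, h₂, h₃⟩ := h
  exact ⟨f y, m, by simp only [← map_pow, ← map_mul, h₁], by simp only [← map_mul, h₂],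
    by simp only [← map_mul, h₃]⟩

theorem drazinSpectrum_subset_spectrum [Algebra ℂ R] (a : R) :
    drazinSpectrum a ⊆ spectrum ℂ a := fun z hz => by
  contrapose! hz
  have h := (spectrum.notMem_iff.mp hz).neg
  rw [neg_sub] at h
  exact fun h' => h' (isDrazinInvertible_of_isUnit h)

end Ring


/-! ### Poles of the resolvent -/

section Poles

variable {A : Type*} [NormedRing A] [NormedAlgebra ℂ A]

/-- Comparison of Taylor coefficients: letting `t` tend to `z` gives `c = -x * H z`, and the divided
slope of `H` satisfies the same equation with constant `-H z`, so another factor `x` can be split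
off. -/
theorem exists_commute_eq_pow_mul {x c : A} {z : ℂ} {H : ℂ → A} (hH : AnalyticAt ℂ H z)
    (hc : ∀ᶠ t in 𝓝[≠] z, (algebraMap ℂ A (t - z) - x) * H t = c)
    (hx : ∀ᶠ t in 𝓝[≠] z, Commute x (H t)) (k : ℕ) :
    ∃ h, Commute x h ∧ c = x ^ k * h := by
  induction k generalizing c H with
  | zero =>
    have h₁ : ∀ᶠ t in 𝓝[≠] z, Commute x c := by
      filter_upwards [hx, hc] with t h₁ h₂
      rw [← h₂]
      exact (((Algebra.commute_algebraMap_right _ x)).sub_right (Commute.refl x)).mul_right h₁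
    exact ⟨c, h₁.exists.choose_spec, by simp⟩
  | succ k ih =>
    have h₀ : c = x * -H z := by
      have t₁ : Filter.Tendsto (fun t => (algebraMap ℂ A (t - z) - x) * H t) (𝓝 z)
          (𝓝 ((algebraMap ℂ A (z - z) - x) * H z)) := by
        refine Filter.Tendsto.mul ?_ hH.continuousAt.tendsto
        exact ((((continuous_algebraMap ℂ A).comp
          (continuous_id.sub continuous_const)).sub continuous_const).tendsto z)
      simpa using tendsto_nhds_unique
        (tendsto_const_nhds.congr' (hc.mono fun t ht => ht.symm))
        (t₁.mono_left nhdsWithin_le_nhds)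
    have hxz : Commute x (H z) := by
      have t₁ : Filter.Tendsto (fun t => x * H t) (𝓝[≠] z) (𝓝 (x * H z)) :=
        (hH.continuousAt.tendsto.const_mul x).mono_left nhdsWithin_le_nhds
      have t₂ : Filter.Tendsto (fun t => H t * x) (𝓝[≠] z) (𝓝 (H z * x)) :=
        (hH.continuousAt.tendsto.mul_const x).mono_left nhdsWithin_le_nhds
      exact tendsto_nhds_unique (t₁.congr' (hx.mono fun t ht => ht.eq)) t₂
    obtain ⟨p, hp⟩ := hH
    have hD : AnalyticAt ℂ (dslope H z) z := hp.has_fpower_series_dslope_fslope.analyticAt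
    have hD' : ∀ t, t ≠ z → dslope H z t = (t - z)⁻¹ • (H t - H z) := fun t ht => by
      rw [dslope_of_ne _ ht, slope_def_module]
    have e : ∀ᶠ t in 𝓝[≠] z, (algebraMap ℂ A (t - z) - x) * dslope H z t = -H z := by
      filter_upwards [hc, self_mem_nhdsWithin] with t h₁ h₂
      have h₃ : t - z ≠ 0 := sub_ne_zero.mpr h₂
      rw [hD' t h₂, mul_smul_comm, mul_sub, h₁, h₀, sub_mul, ← Algebra.smul_def, mul_neg,
        sub_sub_eq_add_sub, neg_add_cancel, zero_sub, smul_neg, inv_smul_smul₀ h₃]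
    obtain ⟨h, hh, hh'⟩ := ih hD e (by
      filter_upwards [hx, self_mem_nhdsWithin] with t h₁ h₂
      rw [hD' t h₂]
      exact (h₁.sub_right hxz).smul_right _)
    exact ⟨h, hh, by rw [h₀, hh', pow_succ', mul_assoc]⟩

theorem isDrazinInvertible_of_mem_poles [CompleteSpace A] {a : A} {z : ℂ} (hz : z ∈ poles a) :
    IsDrazinInvertible (a - algebraMap ℂ A z) := by
  obtain ⟨⟨-, hacc⟩, hord⟩ := hz
  -- A nonzero order excludes the default value 0 of the non-meromorphic case.
  obtain ⟨n, hn⟩ := meromorphicAt_of_meromorphicOrderAt_ne_zero hord.ne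
  have hres : ∀ᶠ t in 𝓝[≠] z, t ∈ resolventSet ℂ a := by
    simpa [accPt_iff_frequently_nhdsNE, spectrum] using hacc
  obtain ⟨x, hx⟩ : ∃ x, x = a - algebraMap ℂ A z := ⟨_, rfl⟩
  rw [← hx]
  have hta : ∀ t, algebraMap ℂ A t - a = algebraMap ℂ A (t - z) - x := fun t => by
    rw [hx, map_sub]; abel
  -- The geometric sum replaces the non-constant `(t - z) ^ n` by the constant `x ^ n` on the right
  -- of the resolvent equation.
  let S : ℂ → A := fun t => ∑ i ∈ Finset.range n, algebraMap ℂ A (t - z) ^ i * x ^ (n - 1 - i)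
  have hxt : ∀ t, Commute (algebraMap ℂ A t) x := fun t => Algebra.commutes t x
  have hS : ∀ t, (algebraMap ℂ A (t - z) - x) * S t = algebraMap ℂ A (t - z) ^ n - x ^ n :=
    fun t => (hxt _).mul_geom_sum₂ n
  have hSa : AnalyticAt ℂ S z := by
    have h : Differentiable ℂ S := by
      have : Differentiable ℂ (fun t : ℂ => algebraMap ℂ A (t - z)) := by
        simp only [Algebra.algebraMap_eq_smul_one]
        fun_prop
      exact Differentiable.fun_sum fun i _ => (this.pow i).mul_const _
    exact h.analyticAt z
  have key : ∀ᶠ t in 𝓝[≠] z, (algebraMap ℂ A (t - z) - x) * ((t - z) ^ n • resolvent a t - S t)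
      = x ^ n := by
    filter_upwards [hres] with t ht
    rw [mul_sub, hS, ← hta, mul_smul_comm, resolvent, Ring.mul_inverse_cancel _ ht,
      ← Algebra.algebraMap_eq_smul_one, map_pow, sub_sub_cancel]
  have hxr : ∀ᶠ t in 𝓝[≠] z, Commute x ((t - z) ^ n • resolvent a t - S t) := by
    filter_upwards [hres] with t ht
    have h₁ : Commute x (algebraMap ℂ A t - a) := by
      rw [hta]
      exact (hxt _).symm.sub_right (Commute.refl x)
    have h₂ : Commute x (resolvent a t) := by
      rw [spectrum.resolvent_eq ht]
      exact Commute.units_inv_right (u := ht.unit) h₁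
    refine (h₂.smul_right _).sub_right ?_
    exact Commute.sum_right _ _ _ fun i _ =>
      ((hxt _).symm.pow_right i).mul_right (Commute.self_pow x _)
  obtain ⟨h, hh, hh'⟩ := exists_commute_eq_pow_mul (hn.sub hSa) key hxr (n + 1)
  exact isDrazinInvertible_of_pow_eq (w := h) (v := h)
    (by rw [← (hh.pow_left _).eq, ← hh']) hh'

end Poles


/-! ### Products in a commutative Banach algebra, by characters -/

section Commutative

theorem mul_pow_eq_zero_of_drazin {R : Type*} [CommRing R] {x y : R} {m : ℕ}
    (h : x ^ m * y * x = x ^ m) : (1 - x * y) * x ^ m = 0 := by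
  linear_combination -h

/-- In a commutative Banach algebra, `u * v - z` is Drazin invertible if `u - s` and `v - t` are
Drazin invertible for all spectral values `s`, `t` with `s * t = z`. -/
theorem isDrazinInvertible_mul_sub_of_comm {C : Type*} [NormedCommRing C] [NormedAlgebra ℂ C]
    [CompleteSpace C] (u v : C) (z : ℂ)
    (h : ∀ s ∈ spectrum ℂ u, ∀ t ∈ spectrum ℂ v, s * t = z →
      IsDrazinInvertible (u - algebraMap ℂ C s) ∧ IsDrazinInvertible (v - algebraMap ℂ C t)) :
    IsDrazinInvertible (u * v - algebraMap ℂ C z) := by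
  obtain ⟨x, hx⟩ : ∃ x, x = u * v - algebraMap ℂ C z := ⟨_, rfl⟩
  rw [← hx]
  -- `1 ∈ J` says exactly that `x` is strongly π-regular. Moreover `x ∈ J`, so a character vanishing
  -- on `J` satisfies `φ u * φ v = z`.
  let J : Ideal C :=
    { carrier := {c | ∃ (n : ℕ) (w : C), c * x ^ n = x ^ (n + 1) * w}
      zero_mem' := ⟨0, 0, by simp⟩
      add_mem' := by
        rintro c d ⟨n, w, hw⟩ ⟨n', w', hw'⟩
        exact ⟨n + n', w + w', by
          linear_combination x ^ n' * hw + x ^ n * hw'⟩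
      smul_mem' := by
        rintro r c ⟨n, w, hw⟩
        exact ⟨n, r * w, by simp only [smul_eq_mul]; linear_combination r * hw⟩ }
  by_cases hJ : J = ⊤
  · obtain ⟨n, w, hw⟩ : (1 : C) ∈ J := hJ ▸ Submodule.mem_top
    rw [one_mul] at hw
    exact isDrazinInvertible_of_pow_eq (w := w) (v := w) (hw.trans (mul_comm _ _)) hw
  exfalso
  obtain ⟨M, hM, hJM⟩ := J.exists_le_maximal hJ
  let φ : C →ₐ[ℂ] ℂ := WeakDual.CharacterSpace.toAlgHom M.toCharacterSpace
  have hφ : ∀ c ∈ J, φ c = 0 := fun c hc => M.toCharacterSpace_apply_eq_zero_of_mem (hJM hc)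
  have hφx : φ u * φ v = z := by
    have := hφ x ⟨0, 1, by simp⟩
    rwa [hx, map_sub, map_mul, AlgHom.commutes, Algebra.algebraMap_self_apply, sub_eq_zero] at this
  obtain ⟨⟨p, m, hp, -, -⟩, ⟨q, n, hq, -, -⟩⟩ :=
    h (φ u) (AlgHom.apply_mem_spectrum φ u) (φ v) (AlgHom.apply_mem_spectrum φ v) hφx
  obtain ⟨s, hs⟩ : ∃ s, s = u - algebraMap ℂ C (φ u) := ⟨_, rfl⟩
  obtain ⟨t, ht⟩ : ∃ t, t = v - algebraMap ℂ C (φ v) := ⟨_, rfl⟩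
  rw [← hs] at hp
  rw [← ht] at hq
  have hs0 : φ s = 0 := by simp [hs]
  have ht0 : φ t = 0 := by simp [ht]
  have hxst : x = s * v + algebraMap ℂ C (φ u) * t := by
    rw [hx, hs, ht, ← hφx, map_mul]; ring
  have hmem : (1 - s * p) * (1 - t * q) ∈ J := by
    have h₁ := mul_pow_eq_zero_of_drazin hp
    have h₂ := mul_pow_eq_zero_of_drazin hq
    have hs' : s ^ m ∣ (s * v) ^ m := ⟨v ^ m, mul_pow _ _ _⟩
    have ht' : t ^ n ∣ (algebraMap ℂ C (φ u) * t) ^ n :=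
      ⟨algebraMap ℂ C (φ u) ^ n, by rw [mul_pow, mul_comm]⟩
    -- Each binomial term contains `s ^ m` or `t ^ n`, and one of the two idempotents kills it.
    have hann : (1 - s * p) * (1 - t * q) * x ^ (m + n) = 0 := by
      rw [hxst, add_pow, Finset.mul_sum]
      refine Finset.sum_eq_zero fun i _ => ?_
      rcases le_total m i with hi | hi
      · obtain ⟨c, hc⟩ := hs'.trans (pow_dvd_pow _ hi)
        rw [hc]
        linear_combination (1 - t * q) * c * (algebraMap ℂ C (φ u) * t) ^ (m + n - i) *
          ((m + n).choose i) * h₁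
      · obtain ⟨c, hc⟩ := ht'.trans (pow_dvd_pow _ (show n ≤ m + n - i by omega))
        rw [hc]
        linear_combination (1 - s * p) * c * (s * v) ^ i * ((m + n).choose i) * h₂
    exact ⟨m + n, 0, by rw [hann, mul_zero]⟩
  have := hφ _ hmem
  simp [hs0, ht0] at this

end Commutative

/-! ### Reduction of the commuting case to the bicommutant -/

section Bicommutant

variable {E : Type*} [NormedRing E] [NormedAlgebra ℂ E] [CompleteSpace E]

/-- For commuting `u`, `v` in a Banach algebra, `u * v - z` is Drazin invertible if `u - s` and
`v - t` are Drazin invertible for all spectral values `s`, `t` with `s * t = z`. -/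
theorem isDrazinInvertible_mul_sub {u v : E} (huv : Commute u v) (z : ℂ)
    (h : ∀ s ∈ spectrum ℂ u, ∀ t ∈ spectrum ℂ v, s * t = z →
      IsDrazinInvertible (u - algebraMap ℂ E s) ∧ IsDrazinInvertible (v - algebraMap ℂ E t)) :
    IsDrazinInvertible (u * v - algebraMap ℂ E z) := by
  -- The bicommutant is closed, commutative since `u` and `v` commute, and contains the inverses and
  -- Drazin inverses needed below.
  let C : Subalgebra ℂ E := Subalgebra.centralizer ℂ (Set.centralizer {u, v})
  have hmem : ∀ {c : E}, c ∈ C ↔ ∀ d, Commute d u → Commute d v → Commute d c := fun {c} => by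
    simp only [C, Subalgebra.mem_centralizer_iff, Set.mem_centralizer_iff, Set.mem_insert_iff,
      Set.mem_singleton_iff, forall_eq_or_imp, forall_eq, and_imp]
    exact ⟨fun h d h₁ h₂ => h d h₁.symm h₂.symm, fun h d h₁ h₂ => h d h₁.symm h₂.symm⟩
  have huC : u ∈ C := hmem.mpr fun d h₁ _ => h₁
  have hvC : v ∈ C := hmem.mpr fun d _ h₂ => h₂
  have hcomm : ∀ c ∈ C, ∀ d ∈ C, c * d = d * c := fun c hc d hd =>
    hmem.mp hd c (hmem.mp hc u (Commute.refl u) huv).symm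
      (hmem.mp hc v huv.symm (Commute.refl v)).symm
  have hclosed : IsClosed (C : Set E) := Set.isClosed_centralizer _
  let _ : NormedCommRing C :=
    { (inferInstance : NormedRing C) with
      mul_comm := fun c d => Subtype.ext (hcomm c c.2 d d.2) }
  let _ : NormedAlgebra ℂ C :=
    { (inferInstance : Algebra ℂ C) with
      norm_smul_le := fun r x => norm_smul_le r (x : E) }
  have : CompleteSpace C := hclosed.completeSpace_coe
  have hdraz : ∀ w ∈ ({u, v} : Set E), ∀ (c : C) (s : ℂ), (c : E) = w →
      IsDrazinInvertible (w - algebraMap ℂ E s) → IsDrazinInvertible (c - algebraMap ℂ C s) := by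
    rintro w hw c s rfl ⟨y, m, h₁, h₂, h₃⟩
    have hy : y ∈ C := hmem.mpr fun d h₄ h₅ => by
      have hd : Commute d (c : E) := by
        rcases hw with hw | hw <;> rw [hw] <;> assumption
      exact commute_of_drazin_inverse h₁ h₂ h₃
        (hd.sub_right (Algebra.commute_algebraMap_right s d))
    exact ⟨⟨y, hy⟩, m, Subtype.ext h₁, Subtype.ext h₂, Subtype.ext h₃⟩
  have hspec : ∀ w ∈ ({u, v} : Set E), ∀ (c : C), (c : E) = w →
      spectrum ℂ c ⊆ spectrum ℂ w := by
    rintro w hw c rfl s hs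
    contrapose! hs
    obtain ⟨U, hU⟩ := spectrum.notMem_iff.mp hs
    have hy : (↑U⁻¹ : E) ∈ C := hmem.mpr fun d h₄ h₅ => by
      have hd : Commute d (c : E) := by
        rcases hw with hw | hw <;> rw [hw] <;> assumption
      refine Commute.units_inv_right ?_
      rw [hU]
      exact (Algebra.commute_algebraMap_right s d).sub_right hd
    refine spectrum.notMem_iff.mpr (IsUnit.of_mul_eq_one (⟨_, hy⟩ : C) (Subtype.ext ?_))
    change (algebraMap ℂ E s - c) * (↑U⁻¹ : E) = 1
    rw [← hU, Units.mul_inv]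
  have key := isDrazinInvertible_mul_sub_of_comm (⟨u, huC⟩ : C) ⟨v, hvC⟩ z fun s hs t ht hst => by
    obtain ⟨h₁, h₂⟩ := h s (hspec u (by simp) _ rfl hs) t (hspec v (by simp) _ rfl ht) hst
    exact ⟨hdraz u (by simp) _ s rfl h₁, hdraz v (by simp) _ t rfl h₂⟩
  exact key.map C.val

end Bicommutant


/-! ### One-sided spectra and isolation of points -/

section OneSided

/-- The complex numbers `z` for which `a - z` has no left inverse. -/
def leftSpectrum {R : Type*} [Ring R] [Algebra ℂ R] (a : R) : Set ℂ :=
  {z | ∀ w, w * (a - algebraMap ℂ R z) ≠ 1}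

/-- The complex numbers `z` for which `a - z` has no right inverse. -/
def rightSpectrum {R : Type*} [Ring R] [Algebra ℂ R] (a : R) : Set ℂ :=
  {z | ∀ w, (a - algebraMap ℂ R z) * w ≠ 1}

theorem isUnit_sub_algebraMap_iff {R : Type*} [Ring R] [Algebra ℂ R] {a : R} {z : ℂ} :
    IsUnit (a - algebraMap ℂ R z) ↔ z ∉ spectrum ℂ a := by
  rw [spectrum.notMem_iff, ← IsUnit.neg_iff, neg_sub]

theorem spectrum_eq_left_union_right {R : Type*} [Ring R] [Algebra ℂ R] (a : R) :
    spectrum ℂ a = leftSpectrum a ∪ rightSpectrum a := by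
  ext z
  rw [← not_iff_not, ← isUnit_sub_algebraMap_iff]
  simp only [leftSpectrum, rightSpectrum, Set.mem_union, Set.mem_ofPred_eq, not_or, not_forall,
    not_not]
  exact ⟨fun h => ⟨h.exists_left_inv, h.exists_right_inv⟩,
    fun ⟨h, h'⟩ => isUnit_iff_exists_and_exists.mpr ⟨h', h⟩⟩

variable {A : Type*} [NormedRing A] [NormedAlgebra ℂ A] [CompleteSpace A]

omit [CompleteSpace A] in
theorem continuous_sub_algebraMap (a : A) : Continuous fun z => a - algebraMap ℂ A z :=
  continuous_const.sub (continuous_algebraMap ℂ A)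

theorem eventually_isUnit_mul_left {a w : A} {z : ℂ} (h : w * (a - algebraMap ℂ A z) = 1) :
    ∀ᶠ t in 𝓝 z, IsUnit (w * (a - algebraMap ℂ A t)) :=
  (Units.isOpen.preimage (continuous_const.mul (continuous_sub_algebraMap a))).mem_nhds
    (h ▸ isUnit_one : IsUnit (w * (a - algebraMap ℂ A z)))

theorem eventually_isUnit_mul_right {a w : A} {z : ℂ} (h : (a - algebraMap ℂ A z) * w = 1) :
    ∀ᶠ t in 𝓝 z, IsUnit ((a - algebraMap ℂ A t) * w) :=
  (Units.isOpen.preimage ((continuous_sub_algebraMap a).mul continuous_const)).mem_nhds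
    (h ▸ isUnit_one : IsUnit ((a - algebraMap ℂ A z) * w))

theorem isClosed_leftSpectrum (a : A) : IsClosed (leftSpectrum a) := by
  rw [← isOpen_compl_iff, isOpen_iff_eventually]
  intro z hz
  simp only [leftSpectrum, Set.mem_compl_iff, Set.mem_ofPred_eq, not_forall, not_not] at hz ⊢
  obtain ⟨w, hw⟩ := hz
  filter_upwards [eventually_isUnit_mul_left hw] with t ht
  obtain ⟨r, hr⟩ := ht.exists_left_inv
  exact ⟨r * w, by rw [mul_assoc, hr]⟩

theorem isClosed_rightSpectrum (a : A) : IsClosed (rightSpectrum a) := by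
  rw [← isOpen_compl_iff, isOpen_iff_eventually]
  intro z hz
  simp only [rightSpectrum, Set.mem_compl_iff, Set.mem_ofPred_eq, not_forall, not_not] at hz ⊢
  obtain ⟨w, hw⟩ := hz
  filter_upwards [eventually_isUnit_mul_right hw] with t ht
  obtain ⟨r, hr⟩ := ht.exists_right_inv
  exact ⟨w * r, by rw [← mul_assoc, hr]⟩

/-- A right inverse `w` at `z` makes `(a - t) * w` a unit for `t` near `z`. If `a - t` became
invertible, so would `w`, and then `a - z` itself. -/
theorem isOpen_left_diff_right (a : A) : IsOpen (leftSpectrum a \ rightSpectrum a) := by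
  rw [isOpen_iff_eventually]
  rintro z ⟨hl, hr⟩
  have hr' := (isClosed_rightSpectrum a).isOpen_compl.mem_nhds hr
  simp only [rightSpectrum, Set.mem_ofPred_eq, not_forall, not_not] at hr
  obtain ⟨w, hw⟩ := hr
  filter_upwards [hr', eventually_isUnit_mul_right hw] with t ht hu
  refine ⟨fun r hrt => ?_, ht⟩
  simp only [rightSpectrum, Set.mem_compl_iff, Set.mem_ofPred_eq, not_forall, not_not] at ht
  obtain ⟨U, hU⟩ : IsUnit (a - algebraMap ℂ A t) := isUnit_iff_exists_and_exists.mpr ⟨ht, r, hrt⟩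
  rw [← hU, Units.isUnit_units_mul] at hu
  obtain ⟨W, rfl⟩ := hu
  have h := Units.eq_inv_of_mul_eq_one_right (u := W) hw
  exact hl W (by rw [h, Units.mul_inv])

theorem isOpen_right_diff_left (a : A) : IsOpen (rightSpectrum a \ leftSpectrum a) := by
  rw [isOpen_iff_eventually]
  rintro z ⟨hr, hl⟩
  have hl' := (isClosed_leftSpectrum a).isOpen_compl.mem_nhds hl
  simp only [leftSpectrum, Set.mem_ofPred_eq, not_forall, not_not] at hl
  obtain ⟨w, hw⟩ := hl
  filter_upwards [hl', eventually_isUnit_mul_left hw] with t ht hu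
  refine ⟨fun r hrt => ?_, ht⟩
  simp only [leftSpectrum, Set.mem_compl_iff, Set.mem_ofPred_eq, not_forall, not_not] at ht
  obtain ⟨U, hU⟩ : IsUnit (a - algebraMap ℂ A t) := isUnit_iff_exists_and_exists.mpr ⟨⟨r, hrt⟩, ht⟩
  rw [← hU, Units.isUnit_mul_units] at hu
  obtain ⟨W, rfl⟩ := hu
  have h := Units.eq_inv_of_mul_eq_one_left (u := W) hw
  exact hr W (by rw [h, Units.inv_mul])

/-- A point at which `a - z` is Drazin invertible is not an accumulation point of the spectrum. -/
theorem eventually_notMem_spectrum {a : A} {z : ℂ}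
    (h : IsDrazinInvertible (a - algebraMap ℂ A z)) : ∀ᶠ t in 𝓝[≠] z, t ∉ spectrum ℂ a := by
  obtain ⟨y, m, h₁, -, h₃⟩ := h
  obtain ⟨x, hx⟩ : ∃ x, x = a - algebraMap ℂ A z := ⟨_, rfl⟩
  rw [← hx] at h₁ h₃
  have hxy : Commute x y := h₃
  have hu : ∀ᶠ t in 𝓝 z, IsUnit (1 - algebraMap ℂ A (t - z) * y) := by
    have hc : Continuous fun t => 1 - algebraMap ℂ A (t - z) * y :=
      continuous_const.sub (((continuous_algebraMap ℂ A).comp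
        (continuous_id.sub continuous_const)).mul continuous_const)
    refine (Units.isOpen.preimage hc).mem_nhds ?_
    simp
  filter_upwards [hu.filter_mono nhdsWithin_le_nhds, self_mem_nhdsWithin] with t ht htz
  have ht0 : t - z ≠ 0 := sub_ne_zero.mpr htz
  rw [← isUnit_sub_algebraMap_iff]
  obtain ⟨r, hr⟩ : ∃ r, r = algebraMap ℂ A (t - z) := ⟨_, rfl⟩
  have hat : a - algebraMap ℂ A t = x - r := by rw [hx, hr, map_sub]; abel
  rw [← hr] at ht
  rw [hat]
  obtain ⟨s, hs⟩ : ∃ s, s = algebraMap ℂ A ((t - z)⁻¹) := ⟨_, rfl⟩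
  have hrs : r ^ m * s ^ m = 1 := by
    rw [hr, hs, ← map_pow, ← map_pow, ← map_mul, ← mul_pow, mul_inv_cancel₀ ht0, one_pow, map_one]
  have cr : ∀ c, Commute c r := fun c => hr ▸ Algebra.commute_algebraMap_right _ c
  have cs : ∀ c, Commute c s := fun c => hs ▸ Algebra.commute_algebraMap_right _ c
  obtain ⟨S, hS⟩ : ∃ S, S = ∑ i ∈ Finset.range m, x ^ i * r ^ (m - 1 - i) := ⟨_, rfl⟩
  have hxS : (x - r) * S = x ^ m - r ^ m := hS ▸ (cr x).mul_geom_sum₂ m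
  have hxp : x ^ m * (1 - x * y) = 0 := by
    rw [mul_sub, mul_one, h₃, ← mul_assoc, h₁, sub_self]
  have cx : ∀ c, Commute x c → Commute (x - r) c := fun c hc => hc.sub_left (cr c).symm
  have hxS' : Commute x S := hS ▸ Commute.sum_right _ _ _ fun i _ =>
    (Commute.self_pow x i).mul_right ((cr x).pow_right _)
  have hcomm : Commute (x - r) (y - S * (1 - x * y) * s ^ m) :=
    cx _ (hxy.sub_right ((hxS'.mul_right ((Commute.one_right x).sub_right
      ((Commute.refl x).mul_right hxy))).mul_right ((cs x).pow_right m)))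
  -- The candidate inverse, up to the unit `1 - r * y`, uses `y` where `x` is invertible and a
  -- finite geometric series on the part cut out by `1 - x * y`, where `x` is nilpotent.
  refine (hcomm.isUnit_mul_iff.mp ?_).1
  have : (x - r) * (y - S * (1 - x * y) * s ^ m) = 1 - r * y := by
    rw [mul_sub, ← mul_assoc, ← mul_assoc, hxS, sub_mul _ _ (1 - x * y), hxp, zero_sub, neg_mul,
      mul_assoc, ((cs _).pow_right m).eq, ← mul_assoc, hrs, one_mul, sub_mul]
    abel
  rwa [this]

end OneSided

/-! ### The planar topological argument -/

section Plane

/-- If `L * L'` and `R * R'` lie in a set that does not accumulate at `z ≠ 0`, then `z` is not a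
product of a point of `L \ R` and a point of `L' ∪ R'`. -/
theorem false_of_mul_eq {L R L' R' K : Set ℂ} (hL : IsClosed L) (hR' : IsClosed R')
    (hbdd : Bornology.IsBounded L) (hLR : IsOpen (L \ R)) (hRL' : IsOpen (R' \ L'))
    (hLK : L * L' ⊆ K) (hRK : R * R' ⊆ K) {z s t : ℂ} (hz : z ≠ 0)
    (hK : ∀ᶠ w in 𝓝[≠] z, w ∉ K) (hs : s ∈ L \ R) (ht : t ∈ L' ∪ R') (hst : s * t = z) :
    False := by
  have hs0 : s ≠ 0 := left_ne_zero_of_mul (hst ▸ hz)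
  have ht0 : t ≠ 0 := right_ne_zero_of_mul (hst ▸ hz)
  -- Otherwise moving `s` inside the open set `L \ R` yields points of `L * L'` accumulating at `z`.
  have htL : t ∉ L' := fun htL => by
    have hm : Filter.Tendsto (fun w => w * t) (𝓝[≠] s) (𝓝[≠] z) := by
      refine tendsto_nhdsWithin_of_tendsto_nhds_of_eventually_within _ ?_ ?_
      · rw [← hst]
        exact ((continuous_mul_const t).tendsto s).mono_left nhdsWithin_le_nhds
      · filter_upwards [self_mem_nhdsWithin] with w hw h
        exact hw (mul_right_cancel₀ ht0 (h.trans hst.symm))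
    obtain ⟨w, hw, hw'⟩ := ((hm.eventually hK).and
      ((hLR.eventually_mem hs).filter_mono nhdsWithin_le_nhds)).exists
    exact hw (hLK (Set.mul_mem_mul hw'.1 htL))
  -- Move the factors in opposite radial directions with constant product `z`. Since `L` is bounded,
  -- the pair must leave the open set; `r` below is its first exit time.
  let γ : ℝ → ℂ := fun r => Complex.exp r * s
  let δ : ℝ → ℂ := fun r => Complex.exp (-r) * t
  have hγ : Continuous γ := by fun_prop
  have hδ : Continuous δ := by fun_prop
  let G : Set ℝ := γ ⁻¹' (L \ R) ∩ δ ⁻¹' (R' \ L')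
  have hG : IsOpen G := (hLR.preimage hγ).inter (hRL'.preimage hδ)
  have h0 : (0 : ℝ) ∈ G := by simpa [G, γ, δ] using ⟨hs, ht.resolve_left htL, htL⟩
  have hT : IsClosed (Set.Ici 0 ∩ Gᶜ) := isClosed_Ici.inter hG.isClosed_compl
  have hbelow : BddBelow (Set.Ici 0 ∩ Gᶜ) := ⟨0, fun r hr => hr.1⟩
  have hne : (Set.Ici 0 ∩ Gᶜ).Nonempty := by
    obtain ⟨M, hM⟩ := hbdd.exists_norm_le
    have hM0 : 0 ≤ M := (norm_nonneg s).trans (hM s hs.1)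
    have hsn : 0 < ‖s‖ := norm_pos_iff.mpr hs0
    refine ⟨M / ‖s‖, div_nonneg hM0 hsn.le, fun h => ?_⟩
    have h₁ := hM _ h.1.1
    simp only [γ, norm_mul, Complex.norm_exp, Complex.ofReal_re] at h₁
    have h₂ := mul_le_mul_of_nonneg_right (Real.add_one_le_exp (M / ‖s‖)) hsn.le
    rw [add_mul, div_mul_cancel₀ _ hsn.ne'] at h₂
    linarith
  obtain ⟨r, hr⟩ : ∃ r, r = sInf (Set.Ici 0 ∩ Gᶜ) := ⟨_, rfl⟩
  have hrT : r ∈ Set.Ici 0 ∩ Gᶜ := hr ▸ hT.csInf_mem hne hbelow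
  have hr0 : 0 < r := lt_of_le_of_ne hrT.1 fun h => hrT.2 (h ▸ h0)
  have hlt : ∀ᶠ q in 𝓝[<] r, q ∈ G := by
    filter_upwards [Ioo_mem_nhdsLT hr0] with q hq
    by_contra h
    exact (hr ▸ hq.2).not_ge (csInf_le hbelow ⟨hq.1.le, h⟩)
  have hγr : γ r ∈ L := hL.mem_of_tendsto ((hγ.tendsto r).mono_left nhdsWithin_le_nhds)
    (hlt.mono fun q hq => hq.1.1)
  have hδr : δ r ∈ R' := hR'.mem_of_tendsto ((hδ.tendsto r).mono_left nhdsWithin_le_nhds)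
    (hlt.mono fun q hq => hq.2.1)
  have hne' : ∀ q p : ℝ, q ≠ p → γ q * δ p ≠ z := fun q p hqp h => by
    have h₁ : γ q * δ p = Complex.exp ((q - p : ℝ) : ℂ) * z := by
      rw [Complex.ofReal_sub, sub_eq_add_neg, Complex.exp_add, ← hst]
      ring
    rw [h₁] at h
    have h₂ := mul_right_cancel₀ hz (h.trans (one_mul z).symm)
    rw [← Complex.ofReal_exp, Complex.ofReal_eq_one, Real.exp_eq_one_iff, sub_eq_zero] at h₂
    exact hqp h₂
  have hrr : γ r * δ r = z := by
    simp only [γ, δ]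
    rw [mul_mul_mul_comm, ← Complex.exp_add, add_neg_cancel, Complex.exp_zero, one_mul, hst]
  -- At the exit, by closedness, either `γ r` has entered `R` or `δ r` has entered `L'`. Pairing
  -- that endpoint with the other curve just before time `r` gives points of `K` accumulating at
  -- `z`.
  by_cases hRr : γ r ∈ R
  · have ht : Filter.Tendsto (fun q => γ r * δ q) (𝓝[<] r) (𝓝[≠] z) := by
      refine tendsto_nhdsWithin_of_tendsto_nhds_of_eventually_within _ ?_ ?_
      · rw [← hrr]
        exact ((continuous_const.mul hδ).tendsto r).mono_left nhdsWithin_le_nhds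
      · filter_upwards [self_mem_nhdsWithin] with q hq
        exact hne' r q (ne_of_gt hq)
    obtain ⟨q, hq, hq'⟩ := ((ht.eventually hK).and hlt).exists
    exact hq (hRK (Set.mul_mem_mul hRr hq'.2.1))
  · have hLr : δ r ∈ L' := by
      by_contra h
      exact hrT.2 ⟨⟨hγr, hRr⟩, hδr, h⟩
    have ht : Filter.Tendsto (fun q => γ q * δ r) (𝓝[<] r) (𝓝[≠] z) := by
      refine tendsto_nhdsWithin_of_tendsto_nhds_of_eventually_within _ ?_ ?_
      · rw [← hrr]
        exact ((hγ.mul continuous_const).tendsto r).mono_left nhdsWithin_le_nhds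
      · filter_upwards [self_mem_nhdsWithin] with q hq
        exact hne' q r (ne_of_lt hq)
    obtain ⟨q, hq, hq'⟩ := ((ht.eventually hK).and hlt).exists
    exact hq (hLK (Set.mul_mem_mul hq'.1.1 hLr))

end Plane


/-! ### Slice maps and transport of regularity -/

section Slices

variable {B E : Type*} [Ring B] [Algebra ℂ B] [Ring E] [Algebra ℂ E]

/-- One factor at a time: `s • (F w * b) - (s * t) • F w` is `s • (F w * (b - t))`. -/
theorem slice_mul_sub_pow {F : E →ₗ[ℂ] B} {e : E} {b : B} {s : ℂ}
    (hF : ∀ w, F (w * e) = s • (F w * b)) (t : ℂ) (w : E) (n : ℕ) :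
    F (w * (e - algebraMap ℂ E (s * t)) ^ n) = s ^ n • (F w * (b - algebraMap ℂ B t) ^ n) := by
  induction n with
  | zero => simp
  | succ n ih =>
    rw [pow_succ, ← mul_assoc, mul_sub, map_sub, hF, ih, ← Algebra.commutes, ← Algebra.smul_def,
      map_smul, ih, pow_succ (b - _), ← mul_assoc, mul_sub, ← Algebra.commutes t, ← Algebra.smul_def,
      smul_sub, smul_mul_assoc]
    simp only [smul_smul, pow_succ]
    congr 2 <;> ring

theorem slice_sub_pow_mul {F : E →ₗ[ℂ] B} {e : E} {b : B} {s : ℂ}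
    (hF : ∀ w, F (e * w) = s • (b * F w)) (t : ℂ) (w : E) (n : ℕ) :
    F ((e - algebraMap ℂ E (s * t)) ^ n * w) = s ^ n • ((b - algebraMap ℂ B t) ^ n * F w) := by
  induction n with
  | zero => simp
  | succ n ih =>
    rw [pow_succ', mul_assoc, sub_mul, map_sub, hF, ih, ← Algebra.smul_def,
      map_smul, ih, pow_succ' (b - _), mul_assoc, sub_mul, ← Algebra.smul_def,
      smul_sub, mul_smul_comm]
    simp only [smul_smul, pow_succ]
    congr 2 <;> ring

/-- The linear maps `F` from `E` to `B` that are left slices at the value `s`: they are unital, and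
they turn right multiplication by `e` into right multiplication by `s • b`. -/
def IsLeftSlice (e : E) (b : B) (s : ℂ) (F : E →ₗ[ℂ] B) : Prop :=
  F 1 = 1 ∧ ∀ w, F (w * e) = s • (F w * b)

/-- The linear maps `F` from `E` to `B` that are right slices at the value `s`: they are unital, and
they turn left multiplication by `e` into left multiplication by `s • b`. -/
def IsRightSlice (e : E) (b : B) (s : ℂ) (F : E →ₗ[ℂ] B) : Prop :=
  F 1 = 1 ∧ ∀ w, F (e * w) = s • (b * F w)

variable {e : E} {b : B} {s t : ℂ} {F : E →ₗ[ℂ] B}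

theorem IsLeftSlice.mul_mem_spectrum (hF : IsLeftSlice e b s F) (ht : t ∈ leftSpectrum b) :
    s * t ∈ spectrum ℂ e := by
  by_contra h
  obtain ⟨w, hw⟩ := (isUnit_sub_algebraMap_iff.mpr h).exists_left_inv
  have := slice_mul_sub_pow hF.2 t w 1
  rw [pow_one, hw, hF.1, pow_one, pow_one, ← smul_mul_assoc] at this
  exact ht _ this.symm

theorem IsRightSlice.mul_mem_spectrum (hF : IsRightSlice e b s F) (ht : t ∈ rightSpectrum b) :
    s * t ∈ spectrum ℂ e := by
  by_contra h
  obtain ⟨w, hw⟩ := (isUnit_sub_algebraMap_iff.mpr h).exists_right_inv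
  have := slice_sub_pow_mul hF.2 t w 1
  rw [pow_one, hw, hF.1, pow_one, pow_one, ← mul_smul_comm] at this
  exact ht _ this.symm

/-- Slicing the left regularity equation of `e - s * t` leaves powers of `s`, which cancel only for
`s ≠ 0`; this is why the point 0 is excluded. -/
theorem IsLeftSlice.exists_pow_eq (hF : IsLeftSlice e b s F) (hs : s ≠ 0)
    (h : IsDrazinInvertible (e - algebraMap ℂ E (s * t))) :
    ∃ (w : B) (n : ℕ), (b - algebraMap ℂ B t) ^ n = w * (b - algebraMap ℂ B t) ^ (n + 1) := by
  obtain ⟨y, n, hy, -⟩ := h.exists_pow_eq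
  refine ⟨s • F y, n, smul_right_injective B (pow_ne_zero n hs) ?_⟩
  have := congrArg F hy
  rw [← one_mul ((e - algebraMap ℂ E (s * t)) ^ n), slice_mul_sub_pow hF.2,
    slice_mul_sub_pow hF.2, hF.1, one_mul] at this
  simp only [this, smul_mul_assoc, smul_smul, pow_succ]

theorem IsRightSlice.exists_pow_eq (hF : IsRightSlice e b s F) (hs : s ≠ 0)
    (h : IsDrazinInvertible (e - algebraMap ℂ E (s * t))) :
    ∃ (w : B) (n : ℕ), (b - algebraMap ℂ B t) ^ n = (b - algebraMap ℂ B t) ^ (n + 1) * w := by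
  obtain ⟨y, n, -, hy⟩ := h.exists_pow_eq
  refine ⟨s • F y, n, smul_right_injective B (pow_ne_zero n hs) ?_⟩
  have := congrArg F hy
  rw [← mul_one ((e - algebraMap ℂ E (s * t)) ^ n), slice_sub_pow_mul hF.2,
    slice_sub_pow_mul hF.2, hF.1, mul_one] at this
  simp only [this, mul_smul_comm, smul_smul, pow_succ]

end Slices

/-! ### The lower bound from slices, and functionals from Hahn-Banach -/

section Abstract

variable {A B E : Type*} [NormedRing A] [NormedAlgebra ℂ A] [CompleteSpace A]
  [NormedRing B] [NormedAlgebra ℂ B] [CompleteSpace B]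
  [NormedRing E] [NormedAlgebra ℂ E] [CompleteSpace E]

theorem mul_mem_drazinSpectrum {a : A} {b : B} {e : E}
    (hl : ∀ s ∈ leftSpectrum a, ∃ F : E →ₗ[ℂ] B, IsLeftSlice e b s F)
    (hr : ∀ s ∈ rightSpectrum a, ∃ F : E →ₗ[ℂ] B, IsRightSlice e b s F) {s t : ℂ}
    (hs : s ∈ spectrum ℂ a) (ht : t ∈ drazinSpectrum b) (hst : s * t ≠ 0) :
    s * t ∈ drazinSpectrum e := fun hD => by
  have hs0 : s ≠ 0 := left_ne_zero_of_mul hst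
  have hK := eventually_notMem_spectrum hD
  have hLK : leftSpectrum a * leftSpectrum b ⊆ spectrum ℂ e := by
    rintro _ ⟨p, hp, q, hq, rfl⟩
    obtain ⟨F, hF⟩ := hl p hp
    exact hF.mul_mem_spectrum hq
  have hRK : rightSpectrum a * rightSpectrum b ⊆ spectrum ℂ e := by
    rintro _ ⟨p, hp, q, hq, rfl⟩
    obtain ⟨F, hF⟩ := hr p hp
    exact hF.mul_mem_spectrum hq
  have hb : Bornology.IsBounded (spectrum ℂ a) := spectrum.isBounded a
  have ht' := drazinSpectrum_subset_spectrum b ht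
  rw [spectrum_eq_left_union_right] at hs hb ht'
  by_cases hsl : s ∈ leftSpectrum a
  · by_cases hsr : s ∈ rightSpectrum a
    · obtain ⟨F, hF⟩ := hl s hsl
      obtain ⟨G, hG⟩ := hr s hsr
      obtain ⟨w, n, hw⟩ := hF.exists_pow_eq hs0 hD
      obtain ⟨v, m, hv⟩ := hG.exists_pow_eq hs0 hD
      exact ht (isDrazinInvertible_of_pow_eq hw hv)
    · exact false_of_mul_eq (isClosed_leftSpectrum a) (isClosed_rightSpectrum b)
        (hb.subset Set.subset_union_left) (isOpen_left_diff_right a) (isOpen_right_diff_left b)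
        hLK hRK hst hK ⟨hsl, hsr⟩ ht' rfl
  · exact false_of_mul_eq (isClosed_rightSpectrum a) (isClosed_leftSpectrum b)
      (hb.subset Set.subset_union_right) (isOpen_right_diff_left a) (isOpen_left_diff_right b)
      hRK hLK hst hK ⟨hs.resolve_left hsl, hsl⟩ ht'.symm rfl

/-- Units form a neighbourhood of 1, so 1 is outside the closure of `S`. Its class in the quotient,
seminormed as `S` need not be closed, therefore has nonzero norm, and Hahn-Banach applies. -/
theorem exists_dual_eq_zero_on (S : Submodule ℂ A) (h : ∀ x ∈ S, ¬ IsUnit x) :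
    ∃ f : StrongDual ℂ A, f 1 = 1 ∧ ∀ x ∈ S, f x = 0 := by
  have h₁ : (1 : A) ∉ closure (S : Set A) := fun h1 => by
    obtain ⟨x, hx, hxS⟩ := mem_closure_iff_nhds.mp h1 _ (Units.isOpen.mem_nhds isUnit_one)
    exact h x hxS hx
  have h₂ : ‖(S.mkQ 1 : A ⧸ S)‖ ≠ 0 := fun h0 =>
    h₁ ((QuotientAddGroup.norm_mk_eq_zero_iff_mem_closure (S := S.toAddSubgroup)).mp h0)
  obtain ⟨g, -, hg⟩ := exists_dual_vector ℂ (S.mkQ 1 : A ⧸ S) h₂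
  let q : A →L[ℂ] A ⧸ S := S.mkQ.mkContinuous 1 fun x => by
    rw [one_mul]; exact Submodule.Quotient.norm_mk_le S x
  have hgC : g (S.mkQ 1) ≠ 0 := by rw [hg]; exact RCLike.ofReal_ne_zero.mpr h₂
  refine ⟨(g (S.mkQ 1))⁻¹ • g.comp q, ?_, fun x hx => ?_⟩
  · exact inv_mul_cancel₀ hgC
  · have : q x = 0 := (Submodule.Quotient.mk_eq_zero S).mpr hx
    simp [this]

theorem exists_dual_of_mem_leftSpectrum {a : A} {s : ℂ} (hs : s ∈ leftSpectrum a) :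
    ∃ f : StrongDual ℂ A, f 1 = 1 ∧ ∀ x, f (x * a) = s * f x := by
  obtain ⟨f, h₁, h₂⟩ := exists_dual_eq_zero_on
    (LinearMap.range (LinearMap.mulRight ℂ (a - algebraMap ℂ A s))) (by
      rintro _ ⟨x, rfl⟩ hx
      obtain ⟨r, hr⟩ := hx.exists_left_inv
      exact hs (r * x) (by rw [mul_assoc]; exact hr))
  refine ⟨f, h₁, fun x => ?_⟩
  have := h₂ _ ⟨x, rfl⟩
  rwa [LinearMap.mulRight_apply, mul_sub, ← Algebra.commutes, ← Algebra.smul_def, map_sub,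
    map_smul, sub_eq_zero] at this

theorem exists_dual_of_mem_rightSpectrum {a : A} {s : ℂ} (hs : s ∈ rightSpectrum a) :
    ∃ f : StrongDual ℂ A, f 1 = 1 ∧ ∀ x, f (a * x) = s * f x := by
  obtain ⟨f, h₁, h₂⟩ := exists_dual_eq_zero_on
    (LinearMap.range (LinearMap.mulLeft ℂ (a - algebraMap ℂ A s))) (by
      rintro _ ⟨x, rfl⟩ hx
      obtain ⟨r, hr⟩ := hx.exists_right_inv
      exact hs (x * r) (by rw [← mul_assoc]; exact hr))
  refine ⟨f, h₁, fun x => ?_⟩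
  have := h₂ _ ⟨x, rfl⟩
  rwa [LinearMap.mulLeft_apply, sub_mul, ← Algebra.smul_def, map_sub,
    map_smul, sub_eq_zero] at this

end Abstract


/-! ### Upper bound and slice maps on the completed tensor product -/

section Completed

variable {A B : Type*} [NormedRing A] [NormedAlgebra ℂ A] [NormedRing B] [NormedAlgebra ℂ B]

theorem elementaryTensor_eq_mul (α : AlgebraNorm ℂ (A ⊗[ℂ] B)) (a : A) (b : B) :
    elementaryTensor α a b = elementaryTensor α a 1 * elementaryTensor α 1 b := by
  rw [elementaryTensor, elementaryTensor, elementaryTensor, ← UniformSpace.Completion.coe_mul,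
    ← map_mul, Algebra.TensorProduct.tmul_mul_tmul, mul_one, one_mul]

theorem commute_elementaryTensor (α : AlgebraNorm ℂ (A ⊗[ℂ] B)) (a : A) (b : B) :
    Commute (elementaryTensor α a 1) (elementaryTensor α 1 b) := by
  rw [Commute, SemiconjBy, elementaryTensor, elementaryTensor, ← UniformSpace.Completion.coe_mul,
    ← UniformSpace.Completion.coe_mul, ← map_mul, ← map_mul, Algebra.TensorProduct.tmul_mul_tmul,
    Algebra.TensorProduct.tmul_mul_tmul, mul_one, one_mul, one_mul, mul_one]

/-- The algebra homomorphism from `A ⊗ B` to its completion. -/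
noncomputable def toCompletedTensor (α : AlgebraNorm ℂ (A ⊗[ℂ] B)) :
    A ⊗[ℂ] B →ₐ[ℂ] CompletedTensor α :=
  { (UniformSpace.Completion.coeRingHom.comp (toNormedTensor α : A ⊗[ℂ] B →+* NormedTensor α)) with
    commutes' := fun _ => rfl }

theorem drazinSpectrum_elementaryTensor_subset (α : AlgebraNorm ℂ (A ⊗[ℂ] B)) (a : A) (b : B) :
    drazinSpectrum (elementaryTensor α a b) ⊆ productSet a b := fun z hz => by
  by_contra h
  refine hz ?_
  let f : A →ₐ[ℂ] CompletedTensor α :=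
    (toCompletedTensor α).comp Algebra.TensorProduct.includeLeft
  let g : B →ₐ[ℂ] CompletedTensor α :=
    (toCompletedTensor α).comp Algebra.TensorProduct.includeRight
  have hf : elementaryTensor α a 1 = f a := rfl
  have hg : elementaryTensor α 1 b = g b := rfl
  rw [elementaryTensor_eq_mul]
  refine isDrazinInvertible_mul_sub (commute_elementaryTensor α a b) z fun s hs t ht hst => ?_
  rw [hf] at hs ⊢
  rw [hg] at ht ⊢
  have hs' := AlgHom.spectrum_apply_subset f a hs
  have ht' := AlgHom.spectrum_apply_subset g b ht
  constructor
  · by_contra hc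
    refine h (Or.inr ⟨s, fun hD => hc ?_, t, ht', hst⟩)
    simpa only [map_sub, AlgHom.commutes] using hD.map f
  · by_contra hc
    refine h (Or.inl ⟨s, hs', t, fun hD => hc ?_, hst⟩)
    simpa only [map_sub, AlgHom.commutes] using hD.map g

variable {α : AlgebraNorm ℂ (A ⊗[ℂ] B)}

theorem ne_zero_norm_one_of_dual {f : StrongDual ℂ A} (hf : f 1 = 1) : ‖(1 : A)‖ ≠ 0 := fun h => by
  rw [norm_eq_zero.mp h, map_zero] at hf
  exact zero_ne_one hf

/-- Uniformity concerns operators from `A` to `A`, so `f` is replaced by the rank-one operator `x ↦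
f x • 1`. It sends `z` to `1 ⊗ (f ⊗ id) z`, whose norm the cross property evaluates; `‖1‖` need not
be 1, hence the division. -/
theorem IsUniformCrossnorm.norm_lid_le (hα : IsUniformCrossnorm α) {f : StrongDual ℂ A}
    (hf : f 1 = 1) : ∃ C, ∀ z : A ⊗[ℂ] B,
      ‖TensorProduct.lid ℂ B (TensorProduct.map (f : A →ₗ[ℂ] ℂ) LinearMap.id z)‖ ≤ C * α z := by
  have h1 := ne_zero_norm_one_of_dual hf
  refine ⟨‖(1 : A)‖⁻¹ * (‖f.smulRight (1 : A)‖ * ‖ContinuousLinearMap.id ℂ B‖), fun z => ?_⟩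
  have e : TensorProduct.map (f.smulRight (1 : A) : A →ₗ[ℂ] A)
      (ContinuousLinearMap.id ℂ B : B →ₗ[ℂ] B) z =
      (1 : A) ⊗ₜ TensorProduct.lid ℂ B (TensorProduct.map (f : A →ₗ[ℂ] ℂ) LinearMap.id z) := by
    induction z with
    | zero => simp
    | tmul x y => simp [TensorProduct.smul_tmul]
    | add x y hx hy => simp only [map_add, TensorProduct.tmul_add, hx, hy]
  have h := hα.uniform (f.smulRight (1 : A)) (ContinuousLinearMap.id ℂ B) z
  rw [e, hα.cross] at h
  rw [mul_assoc]
  exact (le_inv_mul_iff₀ ((norm_nonneg _).lt_of_ne' h1)).mpr h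

theorem IsUniformCrossnorm.norm_rid_le (hα : IsUniformCrossnorm α) {f : StrongDual ℂ B}
    (hf : f 1 = 1) : ∃ C, ∀ z : A ⊗[ℂ] B,
      ‖TensorProduct.rid ℂ A (TensorProduct.map LinearMap.id (f : B →ₗ[ℂ] ℂ) z)‖ ≤ C * α z := by
  have h1 := ne_zero_norm_one_of_dual hf
  refine ⟨‖(1 : B)‖⁻¹ * (‖ContinuousLinearMap.id ℂ A‖ * ‖f.smulRight (1 : B)‖), fun z => ?_⟩
  have e : TensorProduct.map (ContinuousLinearMap.id ℂ A : A →ₗ[ℂ] A)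
      (f.smulRight (1 : B) : B →ₗ[ℂ] B) z =
      TensorProduct.rid ℂ A (TensorProduct.map LinearMap.id (f : B →ₗ[ℂ] ℂ) z) ⊗ₜ (1 : B) := by
    induction z with
    | zero => simp
    | tmul x y => simp [TensorProduct.smul_tmul]
    | add x y hx hy => simp only [map_add, TensorProduct.add_tmul, hx, hy]
  have h := hα.uniform (ContinuousLinearMap.id ℂ A) (f.smulRight (1 : B)) z
  rw [e, hα.cross, mul_comm] at h
  rw [mul_assoc]
  exact (le_inv_mul_iff₀ ((norm_nonneg _).lt_of_ne' h1)).mpr h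

/-- A linear map on `A ⊗ B` that is bounded for `α` extends to the completion. -/
theorem exists_extension_completedTensor {D : Type*} [NormedAddCommGroup D] [NormedSpace ℂ D]
    [CompleteSpace D] (F : A ⊗[ℂ] B →ₗ[ℂ] D) (hF : ∃ C, ∀ z, ‖F z‖ ≤ C * α z) :
    ∃ G : CompletedTensor α →L[ℂ] D, ∀ z, G (toCompletedTensor α z) = F z := by
  obtain ⟨C, hC⟩ := hF
  let F' : NormedTensor α →L[ℂ] D :=
    (F.comp (toNormedTensor α).symm.toLinearMap).mkContinuous C hC
  refine ⟨F'.extend (UniformSpace.Completion.toComplL : NormedTensor α →L[ℂ] _), fun z => ?_⟩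
  exact F'.extend_eq UniformSpace.Completion.denseRange_coe
    (UniformSpace.Completion.isUniformInducing_coe _) (toNormedTensor α z)

theorem elementaryTensor_eq (a : A) (b : B) :
    elementaryTensor α a b = toCompletedTensor α (a ⊗ₜ b) := rfl

theorem completedTensor_induction {p : CompletedTensor α → Prop} (hp : IsClosed {w | p w})
    (h0 : p 0) (ht : ∀ x y, p (toCompletedTensor α (x ⊗ₜ y))) (hadd : ∀ v w, p v → p w → p (v + w))
    (w : CompletedTensor α) : p w := by
  induction w using UniformSpace.Completion.induction_on with
  | hp => exact hp
  | ih w =>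
    change p (toCompletedTensor α ((toNormedTensor α).symm w))
    induction (toNormedTensor α).symm w with
    | zero => rwa [map_zero]
    | tmul x y => exact ht x y
    | add x y hx hy => rw [map_add]; exact hadd _ _ hx hy

theorem IsUniformCrossnorm.exists_isLeftSlice_snd [CompleteSpace B]
    (hα : IsUniformCrossnorm α) {a : A} {s : ℂ} {f : StrongDual ℂ A} (hf : f 1 = 1)
    (hfc : ∀ x, f (x * a) = s * f x) (b : B) :
    ∃ F : CompletedTensor α →ₗ[ℂ] B, IsLeftSlice (elementaryTensor α a b) b s F := by
  obtain ⟨G, hG⟩ := exists_extension_completedTensor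
    ((TensorProduct.lid ℂ B).toLinearMap ∘ₗ TensorProduct.map (f : A →ₗ[ℂ] ℂ) LinearMap.id)
    (hα.norm_lid_le hf)
  refine ⟨G, ?_, fun w => ?_⟩
  · have := hG 1
    rw [map_one, Algebra.TensorProduct.one_def] at this
    simpa [hf] using this
  · induction w using completedTensor_induction with
    | hp => exact isClosed_eq (by fun_prop) (by fun_prop)
    | h0 => simp
    | ht x y =>
      rw [elementaryTensor_eq, ← map_mul, Algebra.TensorProduct.tmul_mul_tmul]
      simp [hG, hfc, mul_smul]
    | hadd v w hv hw => simp only [add_mul, map_add, hv, hw, smul_add]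

theorem IsUniformCrossnorm.exists_isRightSlice_snd [CompleteSpace B]
    (hα : IsUniformCrossnorm α) {a : A} {s : ℂ} {f : StrongDual ℂ A} (hf : f 1 = 1)
    (hfc : ∀ x, f (a * x) = s * f x) (b : B) :
    ∃ F : CompletedTensor α →ₗ[ℂ] B, IsRightSlice (elementaryTensor α a b) b s F := by
  obtain ⟨G, hG⟩ := exists_extension_completedTensor
    ((TensorProduct.lid ℂ B).toLinearMap ∘ₗ TensorProduct.map (f : A →ₗ[ℂ] ℂ) LinearMap.id)
    (hα.norm_lid_le hf)
  refine ⟨G, ?_, fun w => ?_⟩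
  · have := hG 1
    rw [map_one, Algebra.TensorProduct.one_def] at this
    simpa [hf] using this
  · induction w using completedTensor_induction with
    | hp => exact isClosed_eq (by fun_prop) (by fun_prop)
    | h0 => simp
    | ht x y =>
      rw [elementaryTensor_eq, ← map_mul, Algebra.TensorProduct.tmul_mul_tmul]
      simp [hG, hfc, mul_smul]
    | hadd v w hv hw => simp only [mul_add, map_add, hv, hw, smul_add]

theorem IsUniformCrossnorm.exists_isLeftSlice_fst [CompleteSpace A]
    (hα : IsUniformCrossnorm α) {b : B} {s : ℂ} {f : StrongDual ℂ B} (hf : f 1 = 1)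
    (hfc : ∀ x, f (x * b) = s * f x) (a : A) :
    ∃ F : CompletedTensor α →ₗ[ℂ] A, IsLeftSlice (elementaryTensor α a b) a s F := by
  obtain ⟨G, hG⟩ := exists_extension_completedTensor
    ((TensorProduct.rid ℂ A).toLinearMap ∘ₗ TensorProduct.map LinearMap.id (f : B →ₗ[ℂ] ℂ))
    (hα.norm_rid_le hf)
  refine ⟨G, ?_, fun w => ?_⟩
  · have := hG 1
    rw [map_one, Algebra.TensorProduct.one_def] at this
    simpa [hf] using this
  · induction w using completedTensor_induction with
    | hp => exact isClosed_eq (by fun_prop) (by fun_prop)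
    | h0 => simp
    | ht x y =>
      rw [elementaryTensor_eq, ← map_mul, Algebra.TensorProduct.tmul_mul_tmul]
      simp [hG, hfc, mul_smul]
    | hadd v w hv hw => simp only [add_mul, map_add, hv, hw, smul_add]

theorem IsUniformCrossnorm.exists_isRightSlice_fst [CompleteSpace A]
    (hα : IsUniformCrossnorm α) {b : B} {s : ℂ} {f : StrongDual ℂ B} (hf : f 1 = 1)
    (hfc : ∀ x, f (b * x) = s * f x) (a : A) :
    ∃ F : CompletedTensor α →ₗ[ℂ] A, IsRightSlice (elementaryTensor α a b) a s F := by
  obtain ⟨G, hG⟩ := exists_extension_completedTensor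
    ((TensorProduct.rid ℂ A).toLinearMap ∘ₗ TensorProduct.map LinearMap.id (f : B →ₗ[ℂ] ℂ))
    (hα.norm_rid_le hf)
  refine ⟨G, ?_, fun w => ?_⟩
  · have := hG 1
    rw [map_one, Algebra.TensorProduct.one_def] at this
    simpa [hf] using this
  · induction w using completedTensor_induction with
    | hp => exact isClosed_eq (by fun_prop) (by fun_prop)
    | h0 => simp
    | ht x y =>
      rw [elementaryTensor_eq, ← map_mul, Algebra.TensorProduct.tmul_mul_tmul]
      simp [hG, hfc, mul_smul]
    | hadd v w hv hw => simp only [mul_add, map_add, hv, hw, smul_add]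

theorem IsUniformCrossnorm.productSet_diff_subset [CompleteSpace A] [CompleteSpace B]
    (hα : IsUniformCrossnorm α) (a : A) (b : B) :
    productSet a b \ {0} ⊆ drazinSpectrum (elementaryTensor α a b) := by
  rintro _ ⟨⟨s, hs, t, ht, rfl⟩ | ⟨s, hs, t, ht, rfl⟩, h0⟩
  · refine mul_mem_drazinSpectrum (fun p hp => ?_) (fun p hp => ?_) hs ht h0
    · obtain ⟨f, hf, hfa⟩ := exists_dual_of_mem_leftSpectrum hp
      exact hα.exists_isLeftSlice_snd hf hfa b
    · obtain ⟨f, hf, hfa⟩ := exists_dual_of_mem_rightSpectrum hp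
      exact hα.exists_isRightSlice_snd hf hfa b
  · change s * t ∈ _
    change s * t ≠ 0 at h0
    -- The factors exchange roles: functionals on `B` now give slices with values in `A`.
    rw [mul_comm] at h0 ⊢
    refine mul_mem_drazinSpectrum (fun p hp => ?_) (fun p hp => ?_) ht hs h0
    · obtain ⟨f, hf, hfb⟩ := exists_dual_of_mem_leftSpectrum hp
      exact hα.exists_isLeftSlice_fst hf hfb a
    · obtain ⟨f, hf, hfb⟩ := exists_dual_of_mem_rightSpectrum hp
      exact hα.exists_isRightSlice_fst hf hfb a

end Completed

theorem drazinSpectrum_eq_empty_of_spectrum_eq_poles {A : Type*} [NormedRing A] [NormedAlgebra ℂ A]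
    [CompleteSpace A] {a : A} (h : spectrum ℂ a = poles a) : drazinSpectrum a = ∅ :=
  Set.eq_empty_of_forall_notMem fun _ hz =>
    hz (isDrazinInvertible_of_mem_poles (h ▸ drazinSpectrum_subset_spectrum a hz))

end DrazinTensor

theorem theorem4p1 {A B : Type*}
    [NormedRing A] [NormedAlgebra ℂ A] [CompleteSpace A]
    [NormedRing B] [NormedAlgebra ℂ B] [CompleteSpace B]
    (α : AlgebraNorm ℂ (A ⊗[ℂ] B)) (hα : IsUniformCrossnorm α) (a : A) (b : B) :
    (spectrum ℂ a = poles a → spectrum ℂ b = poles b →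
      productSet a b = ∅ ∧ drazinSpectrum (elementaryTensor α a b) = ∅) ∧
    ((drazinSpectrum a).Nonempty ∨ (drazinSpectrum b).Nonempty →
      drazinSpectrum (elementaryTensor α a b) \ {0} = productSet a b \ {0} ∧
      drazinSpectrum (elementaryTensor α a b) ⊆ productSet a b) := by
  have hsub := drazinSpectrum_elementaryTensor_subset α a b
  refine ⟨fun ha hb => ?_, fun _ =>
    ⟨Set.Subset.antisymm (Set.sdiff_subset_sdiff_left hsub) ?_, hsub⟩⟩
  · have h : productSet a b = ∅ := by
      simp [productSet, drazinSpectrum_eq_empty_of_spectrum_eq_poles ha,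
        drazinSpectrum_eq_empty_of_spectrum_eq_poles hb]
    exact ⟨h, Set.subset_empty_iff.mp (h ▸ hsub)⟩
  · exact fun z hz => ⟨hα.productSet_diff_subset a b hz, hz.2⟩
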